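/- Consider real solutions $y$ of the first Painlevé equation $y''=6y^2-x$, each taken on its interval of existence, i.e. its maximal open interval of existence in $\mathbb R$. For $x_0\le 0$ let $$X_{min}(x_0)=\inf_{y_0\in\mathbb R,\ y_1\ge 0} x_{min},$$ where $x_{min}=x_{min}(x_0,y_0,y_1)\le x_0$ is the point at which the solution with $y(x_0)=y_0$, $y'(x_0)=y_1$ attains its minimum over the part of its interval of existence in $(-\infty,x_0]$. Let $$C=\max_{v<0}\int_0^{+\infty}\frac{dw}{\sqrt{w^4+3vw^2+3v^2+1/2}}.$$ The maximum defining $C$ is attained, and $X_{min}(x_0)$ is finite for every $x_0\le 0$. Moreover: 1. For every $x_0\le 0$ the equation $\eta^5-|x_0|\eta=C$ has a unique positive root $\eta(x_0)$, and $$X_{min}(x_0)<-\eta(x_0)^4=x_0-\frac{C}{\eta(x_0)}.$$ 2. For every $x_0<0$, $$x_0-\frac{C}{|x_0|^{1/4}}<X_{min}(x_0)<x_0-\frac{C}{\big||x_0|+C/|x_0|^{1/4}\big|^{1/4}}.$$ 3. As $x_0\to-\infty$, $$X_{min}(x_0)=x_0-\frac{C}{|x_0|^{1/4}}+R(x_0),\qquad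 R(x_0)=\mathcal O\big(|x_0|^{-3/2}\big),$$ and $0<R(x_0)<\dfrac{C^2}{4|x_0|^{3/2}}$ whenever $x_0\le 0$ and $|x_0|>C^{4/5}$. -/

import Mathlib

namespace PainleveOne

/-- `y` is a (real, twice differentiable) solution of `y'' = 6 y ^ 2 - x` on the open
interval `I`, which may be bounded or unbounded on either side. Only the values of `y` on `I`
matter. -/
structure IsSolution (y : ℝ → ℝ) (I : Set ℝ) : Prop where
  isOpen : IsOpen I
  ordConnected : I.OrdConnected
  hasDerivAt : ∀ x ∈ I, HasDerivAt y (deriv y x) x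
  hasDerivAt_deriv : ∀ x ∈ I, HasDerivAt (deriv y) (6 * y x ^ 2 - x) x

/-- `y` is a solution with (maximal) interval of existence `I`: it is not the restriction of a
solution on a larger open interval. -/
def IsMaximalSolution (y : ℝ → ℝ) (I : Set ℝ) : Prop :=
  IsSolution y I ∧
    ∀ (z : ℝ → ℝ) (J : Set ℝ), IsSolution z J → I ⊆ J → Set.EqOn z y I → J = I

/-- `m` is a point at which the maximal solution with initial values `y(x₀) = y₀`,
`y'(x₀) = y₁` attains its minimum over the part of its interval of existence that is not to the
right of `x₀`. -/
def IsMinPoint (x₀ y₀ y₁ m : ℝ) : Prop :=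
  ∃ (y : ℝ → ℝ) (I : Set ℝ), IsMaximalSolution y I ∧
    x₀ ∈ I ∧ y x₀ = y₀ ∧ deriv y x₀ = y₁ ∧
    m ∈ I ∩ Set.Iic x₀ ∧ IsMinOn y (I ∩ Set.Iic x₀) m

/-- The positions of the minima of all the solutions with nonnegative slope at `x₀`. -/
def minPoints (x₀ : ℝ) : Set ℝ :=
  {m | ∃ y₀ y₁ : ℝ, 0 ≤ y₁ ∧ IsMinPoint x₀ y₀ y₁ m}

/-- `X_min(x₀)`, the infimum of the positions of the minima. -/
noncomputable def Xmin (x₀ : ℝ) : ℝ := sInf (minPoints x₀)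

/-- `∫₀^∞ dw / √(w⁴ + 3 v w² + 3 v² + 1/2)`; the radicand is positive for all real `v`, `w`. -/
noncomputable def ellipticIntegral (v : ℝ) : ℝ :=
  ∫ w in Set.Ioi (0 : ℝ), 1 / Real.sqrt (w ^ 4 + 3 * v * w ^ 2 + 3 * v ^ 2 + 1 / 2)

/-- The constant `C`, the maximum over `v < 0` of the integral above. -/
noncomputable def C : ℝ := sSup (ellipticIntegral '' Set.Iio 0)

end PainleveOne

/-!
On the negative axis a solution `y` with minimum `a` at `m` obeys `y'' = 6 y ^ 2 - x`, and for a
constant force `c` in place of `-x` energy conservation gives the time needed to rise from the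
minimum to any height, or to infinity, as an explicit integral. By scaling, the longest blow-up
time over all `a` is `C / c ^ (1 / 4)`.

Between `m` and `x₀` the force `-x` is at least `-x₀`, so `y` rises at least as fast as with the
constant force `-x₀`; as it is still finite at `x₀`, this gives `x₀ - m < C / |x₀| ^ (1 / 4)`.
Conversely the force is at most `-m`, so the solution at rest at `m` with the minimum that
maximizes the blow-up time lives at least for the time `C / (-m) ^ (1 / 4)`; equating this with
`x₀ - m` for `m = -η ^ 4` produces the quintic `η ^ 5 - |x₀| η = C`. The two inequalities stay
strict for the infimum because the force strictly exceeds `-x₀`, or falls strictly below `-m`,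
during a part of the rise, which is quantified by a comparison with two successive constant forces.
-/

open Set Filter Topology MeasureTheory

namespace PainleveOne

/-! ### Travel times for a constant force -/

/-- If `y'' = 6 y ^ 2 + c` has minimum value `a`, energy conservation reads
`y' ^ 2 = 4 (y - a) * radicand a c √(y - a)`. -/
noncomputable def radicand (a c s : ℝ) : ℝ := s ^ 4 + 3 * a * s ^ 2 + 3 * a ^ 2 + c / 2

theorem radicand_eq_add_half (a c s : ℝ) :
    radicand a c s = s ^ 4 / 4 + 3 / 4 * (s ^ 2 + 2 * a) ^ 2 + c / 2 := by
  unfold radicand; ring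

theorem half_le_radicand (a c s : ℝ) : c / 2 ≤ radicand a c s := by
  have : 0 ≤ s ^ 4 / 4 + 3 / 4 * (s ^ 2 + 2 * a) ^ 2 := by positivity
  linarith [radicand_eq_add_half a c s]

theorem radicand_pos {c : ℝ} (a : ℝ) (hc : 0 < c) (s : ℝ) : 0 < radicand a c s :=
  (half_pos hc).trans_le (half_le_radicand a c s)

theorem sqrt_radicand_pos {c : ℝ} (a : ℝ) (hc : 0 < c) (s : ℝ) : 0 < √(radicand a c s) :=
  Real.sqrt_pos.2 (radicand_pos a hc s)

/-- The reciprocal speed along `y'' = 6 y ^ 2 + c`, in the variable `s = √(y - a)`, where `a` is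
the minimum value of `y`. -/
noncomputable def slowness (a c s : ℝ) : ℝ := 1 / √(radicand a c s)

theorem slowness_pos {c : ℝ} (a : ℝ) (hc : 0 < c) (s : ℝ) : 0 < slowness a c s :=
  one_div_pos.2 (sqrt_radicand_pos a hc s)

theorem continuousAt_slowness {p : ℝ × ℝ × ℝ} (hp : 0 < p.2.1) :
    ContinuousAt (fun q : ℝ × ℝ × ℝ => slowness q.1 q.2.1 q.2.2) p := by
  unfold slowness
  refine continuousAt_const.div (ContinuousAt.sqrt ?_) (sqrt_radicand_pos _ hp _).ne'
  unfold radicand; fun_prop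

theorem continuous_slowness {c : ℝ} (a : ℝ) (hc : 0 < c) : Continuous (slowness a c) :=
  continuous_iff_continuousAt.2 fun s =>
    (continuousAt_slowness (p := (a, c, s)) hc).comp (f := fun s : ℝ => (a, c, s)) (by fun_prop)

theorem slowness_strictAnti {c d : ℝ} (a : ℝ) (hc : 0 < c) (hcd : c < d) (s : ℝ) :
    slowness a d s < slowness a c s := by
  refine one_div_lt_one_div_of_lt (sqrt_radicand_pos a hc s)
    (Real.sqrt_lt_sqrt (radicand_pos a hc s).le ?_)
  unfold radicand; linarith

theorem slowness_le_inv_sqrt_half {c : ℝ} (a : ℝ) (hc : 0 < c) (s : ℝ) :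
    slowness a c s ≤ 1 / √(c / 2) :=
  one_div_le_one_div_of_le (Real.sqrt_pos.2 (half_pos hc))
    (Real.sqrt_le_sqrt (half_le_radicand a c s))

theorem exists_slowness_le {c₀ : ℝ} (hc₀ : 0 < c₀) :
    ∃ K : ℝ, ∀ a c s : ℝ, c₀ ≤ c → slowness a c s ≤ K * (1 + s ^ 2)⁻¹ := by
  obtain ⟨k, hk, hk₁, hk₂⟩ : ∃ k : ℝ, 0 < k ∧ k ≤ 1 / 8 ∧ k ≤ c₀ / 4 :=
    ⟨min (1 / 8) (c₀ / 4), by positivity, min_le_left _ _, min_le_right _ _⟩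
  refine ⟨1 / √k, fun a c s hc => ?_⟩
  have hle : √k * (1 + s ^ 2) ≤ √(radicand a c s) := by
    refine Real.le_sqrt_of_sq_le ?_
    rw [mul_pow, Real.sq_sqrt hk.le, radicand_eq_add_half]
    have : (1 + s ^ 2) ^ 2 ≤ 2 + 2 * s ^ 4 := by nlinarith [sq_nonneg (s ^ 2 - 1)]
    nlinarith [sq_nonneg (s ^ 2 + 2 * a), pow_nonneg (sq_nonneg s) 2]
  calc slowness a c s ≤ 1 / (√k * (1 + s ^ 2)) := one_div_le_one_div_of_le (by positivity) hle
    _ = 1 / √k * (1 + s ^ 2)⁻¹ := by rw [← one_div_mul_one_div, one_div (1 + s ^ 2)]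

theorem norm_slowness {c : ℝ} (a : ℝ) (hc : 0 < c) (s : ℝ) : ‖slowness a c s‖ = slowness a c s :=
  Real.norm_of_nonneg (slowness_pos a hc s).le

theorem integrable_slowness {c : ℝ} (a : ℝ) (hc : 0 < c) : Integrable (slowness a c) := by
  obtain ⟨K, hK⟩ := exists_slowness_le hc
  refine (integrable_inv_one_add_sq.const_mul K).mono'
    (continuous_slowness a hc).aestronglyMeasurable (Eventually.of_forall fun s => ?_)
  rw [norm_slowness a hc]
  exact hK a c s le_rfl

theorem continuousAt_setIntegral_slowness (S : Set ℝ) {p : ℝ × ℝ} (hp : 0 < p.2) :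
    ContinuousAt (fun q : ℝ × ℝ => ∫ s in S, slowness q.1 q.2 s) p := by
  obtain ⟨K, hK⟩ := exists_slowness_le (half_pos hp)
  have hev : ∀ᶠ q : ℝ × ℝ in 𝓝 p, p.2 / 2 < q.2 :=
    continuous_snd.continuousAt.eventually (lt_mem_nhds (half_lt_self hp))
  refine continuousAt_of_dominated (bound := fun s => K * (1 + s ^ 2)⁻¹) ?_ ?_
    (integrable_inv_one_add_sq.const_mul K).integrableOn ?_
  · filter_upwards [hev] with q hq
    exact (continuous_slowness q.1 ((half_pos hp).trans hq)).aestronglyMeasurable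
  · filter_upwards [hev] with q hq
    refine Eventually.of_forall fun s => ?_
    rw [norm_slowness _ ((half_pos hp).trans hq)]
    exact hK _ _ _ hq.le
  · exact Eventually.of_forall fun s =>
      (continuousAt_slowness (p := (p.1, p.2, s)) hp).comp
        (f := fun q : ℝ × ℝ => (q.1, q.2, s)) (by fun_prop)

theorem tendsto_slowness_cocompact {c : ℝ} (hc : 0 < c) (s : ℝ) :
    Tendsto (fun a => slowness a c s) (cocompact ℝ) (𝓝 0) := by
  have hlim : Tendsto (fun a : ℝ => 2 * |a|⁻¹) (cocompact ℝ) (𝓝 0) := by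
    simpa using (tendsto_inv_atTop_zero.comp (tendsto_norm_cocompact_atTop (E := ℝ))).const_mul 2
  refine squeeze_zero' (Eventually.of_forall fun a => (slowness_pos a hc s).le) ?_ hlim
  filter_upwards [(isCompact_singleton (x := (0 : ℝ))).compl_mem_cocompact] with a ha
  have ha : 0 < |a| := abs_pos.2 ha
  have hle : |a| / 2 ≤ √(radicand a c s) := by
    refine Real.le_sqrt_of_sq_le ?_
    rw [div_pow, sq_abs]
    unfold radicand
    nlinarith [sq_nonneg (2 * s ^ 2 + 3 * a), sq_nonneg a]
  calc slowness a c s ≤ 1 / (|a| / 2) := one_div_le_one_div_of_le (by positivity) hle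
    _ = 2 * |a|⁻¹ := by field_simp

theorem tendsto_setIntegral_slowness_cocompact (S : Set ℝ) {c : ℝ} (hc : 0 < c) :
    Tendsto (fun a => ∫ s in S, slowness a c s) (cocompact ℝ) (𝓝 0) := by
  obtain ⟨K, hK⟩ := exists_slowness_le hc
  have : IsCountablyGenerated (cocompact ℝ) := by
    rw [cocompact_eq_atBot_atTop]; infer_instance
  simpa using tendsto_integral_filter_of_dominated_convergence (μ := volume.restrict S)
    (f := fun _ => (0 : ℝ)) (fun s => K * (1 + s ^ 2)⁻¹)
    (Eventually.of_forall fun a => (continuous_slowness a hc).aestronglyMeasurable)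
    (Eventually.of_forall fun a => Eventually.of_forall fun s =>
      (norm_slowness a hc s).trans_le (hK a c s le_rfl))
    (integrable_inv_one_add_sq.const_mul K).integrableOn
    (Eventually.of_forall (tendsto_slowness_cocompact hc))

/-- The time a solution of `y'' = 6 y ^ 2 + c` needs to rise from its minimum `a` to
`a + s ^ 2`. -/
noncomputable def riseTime (a c s : ℝ) : ℝ := ∫ σ in (0 : ℝ)..s, slowness a c σ

/-- The time a solution of `y'' = 6 y ^ 2 + c` needs to blow up from its minimum `a`. -/
noncomputable def blowupTime (a c : ℝ) : ℝ := ∫ s in Ioi (0 : ℝ), slowness a c s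

theorem hasDerivAt_riseTime {c : ℝ} (a : ℝ) (hc : 0 < c) (s : ℝ) :
    HasDerivAt (riseTime a c) (slowness a c s) s :=
  intervalIntegral.integral_hasDerivAt_right
    ((continuous_slowness a hc).intervalIntegrable _ _)
    (continuous_slowness a hc).stronglyMeasurable.stronglyMeasurableAtFilter
    (continuous_slowness a hc).continuousAt

@[simp]
theorem riseTime_zero (a c : ℝ) : riseTime a c 0 = 0 := by simp [riseTime]

theorem strictMono_riseTime {c : ℝ} (a : ℝ) (hc : 0 < c) : StrictMono (riseTime a c) :=
  strictMono_of_hasDerivAt_pos (hasDerivAt_riseTime a hc) (slowness_pos a hc)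

theorem tendsto_riseTime {c : ℝ} (a : ℝ) (hc : 0 < c) :
    Tendsto (riseTime a c) atTop (𝓝 (blowupTime a c)) :=
  intervalIntegral_tendsto_integral_Ioi 0 (integrable_slowness a hc).integrableOn tendsto_id

theorem riseTime_lt_blowupTime {c : ℝ} (a : ℝ) (hc : 0 < c) (s : ℝ) :
    riseTime a c s < blowupTime a c :=
  (strictMono_riseTime a hc (lt_add_one s)).trans_le
    ((strictMono_riseTime a hc).monotone.ge_of_tendsto (tendsto_riseTime a hc) _)

theorem blowupTime_pos {c : ℝ} (a : ℝ) (hc : 0 < c) : 0 < blowupTime a c := by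
  simpa using riseTime_lt_blowupTime a hc 0

theorem riseTime_le_div {c s : ℝ} (a : ℝ) (hc : 0 < c) (hs : 0 ≤ s) :
    riseTime a c s ≤ s / √(c / 2) := by
  have := intervalIntegral.integral_mono_on (μ := volume) hs
    ((continuous_slowness a hc).intervalIntegrable _ _)
    (continuous_const.intervalIntegrable _ _) fun σ _ => slowness_le_inv_sqrt_half a hc σ
  rwa [intervalIntegral.integral_const, sub_zero, smul_eq_mul, mul_one_div] at this

theorem strictMono_riseTime_sub {c d : ℝ} (a : ℝ) (hc : 0 < c) (hcd : c < d) :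
    StrictMono fun s => riseTime a c s - riseTime a d s :=
  strictMono_of_hasDerivAt_pos
    (fun s => (hasDerivAt_riseTime a hc s).sub (hasDerivAt_riseTime a (hc.trans hcd) s))
    fun s => sub_pos.2 (slowness_strictAnti a hc hcd s)

theorem continuousAt_blowupTime {p : ℝ × ℝ} (hp : 0 < p.2) :
    ContinuousAt (fun q : ℝ × ℝ => blowupTime q.1 q.2) p :=
  continuousAt_setIntegral_slowness _ hp

theorem continuousAt_riseTime {s : ℝ} (hs : 0 ≤ s) {p : ℝ × ℝ} (hp : 0 < p.2) :
    ContinuousAt (fun q : ℝ × ℝ => riseTime q.1 q.2 s) p := by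
  simp only [riseTime, intervalIntegral.integral_of_le hs]
  exact continuousAt_setIntegral_slowness _ hp

theorem tendsto_blowupTime_cocompact {c : ℝ} (hc : 0 < c) :
    Tendsto (fun a => blowupTime a c) (cocompact ℝ) (𝓝 0) :=
  tendsto_setIntegral_slowness_cocompact _ hc

theorem tendsto_riseTime_cocompact {c s : ℝ} (hc : 0 < c) (hs : 0 ≤ s) :
    Tendsto (fun a => riseTime a c s) (cocompact ℝ) (𝓝 0) := by
  simp only [riseTime, intervalIntegral.integral_of_le hs]
  exact tendsto_setIntegral_slowness_cocompact _ hc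

theorem exists_forall_le_of_tendsto_cocompact {f : ℝ → ℝ} (hf : Continuous f)
    (h0 : 0 < f 0) (hlim : Tendsto f (cocompact ℝ) (𝓝 0)) : ∃ a, ∀ b, f b ≤ f a :=
  hf.exists_forall_ge' 0 ((hlim.eventually (gt_mem_nhds h0)).mono fun _ h => h.le)

/-- The blow-up time from the minimum `a` when the force is `d` up to the height `a + s ^ 2` and
`c` from there on. -/
noncomputable def twoStageBlowupTime (a d c s : ℝ) : ℝ :=
  blowupTime a c - riseTime a c s + riseTime a d s

section twoStageBlowupTime

variable {a c d s : ℝ}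

theorem twoStageBlowupTime_lt_blowupTime (hc : 0 < c) (hcd : c < d) (hs : 0 < s) :
    twoStageBlowupTime a d c s < blowupTime a c := by
  have := strictMono_riseTime_sub a hc hcd hs
  simp only [riseTime_zero, sub_self] at this
  unfold twoStageBlowupTime
  linarith

theorem antitone_twoStageBlowupTime (hc : 0 < c) (hcd : c < d) :
    Antitone (twoStageBlowupTime a d c) := fun s t hst => by
  have : riseTime a c s - riseTime a d s ≤ riseTime a c t - riseTime a d t :=
    (strictMono_riseTime_sub a hc hcd).monotone hst
  unfold twoStageBlowupTime
  linarith

theorem twoStageBlowupTime_pos (hc : 0 < c) (hd : 0 < d) (hs : 0 ≤ s) :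
    0 < twoStageBlowupTime a d c s := by
  have := (strictMono_riseTime a hd).monotone hs
  rw [riseTime_zero] at this
  unfold twoStageBlowupTime
  linarith [riseTime_lt_blowupTime a hc s]

theorem blowupTime_lt_twoStageBlowupTime (hc : 0 < c) (hcd : c < d) :
    blowupTime a d < twoStageBlowupTime a d c s := by
  have hmono := strictMono_riseTime_sub a hc hcd
  have := (hmono (lt_add_one s)).trans_le <| hmono.monotone.ge_of_tendsto
    ((tendsto_riseTime a hc).sub (tendsto_riseTime a (hc.trans hcd))) _
  simp only at this
  unfold twoStageBlowupTime
  linarith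

theorem continuousAt_twoStageBlowupTime {p : ℝ × ℝ × ℝ} (hd : 0 < p.2.1) (hc : 0 < p.2.2)
    (hs : 0 ≤ s) :
    ContinuousAt (fun q : ℝ × ℝ × ℝ => twoStageBlowupTime q.1 q.2.1 q.2.2 s) p := by
  unfold twoStageBlowupTime
  refine ContinuousAt.add (ContinuousAt.sub ?_ ?_) ?_
  · exact ContinuousAt.comp (g := fun q : ℝ × ℝ => blowupTime q.1 q.2)
      (f := fun q : ℝ × ℝ × ℝ => (q.1, q.2.2)) (continuousAt_blowupTime hc) (by fun_prop)
  · exact ContinuousAt.comp (g := fun q : ℝ × ℝ => riseTime q.1 q.2 s)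
      (f := fun q : ℝ × ℝ × ℝ => (q.1, q.2.2)) (continuousAt_riseTime hs hc) (by fun_prop)
  · exact ContinuousAt.comp (g := fun q : ℝ × ℝ => riseTime q.1 q.2 s)
      (f := fun q : ℝ × ℝ × ℝ => (q.1, q.2.1)) (continuousAt_riseTime hs hd) (by fun_prop)

theorem exists_forall_twoStageBlowupTime_le (hc : 0 < c) (hd : 0 < d) (hs : 0 ≤ s) :
    ∃ a, ∀ b, twoStageBlowupTime b d c s ≤ twoStageBlowupTime a d c s := by
  refine exists_forall_le_of_tendsto_cocompact (f := fun a => twoStageBlowupTime a d c s)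
    (continuous_iff_continuousAt.2 fun a => ?_) (twoStageBlowupTime_pos hc hd hs) ?_
  · exact (continuousAt_twoStageBlowupTime (p := (a, d, c)) hd hc hs).comp
      (f := fun a : ℝ => (a, d, c)) (by fun_prop)
  · simpa [twoStageBlowupTime] using ((tendsto_blowupTime_cocompact hc).sub
      (tendsto_riseTime_cocompact hc hs)).add (tendsto_riseTime_cocompact hd hs)

end twoStageBlowupTime

/-! ### The constant `C` -/

theorem hasDerivAt_slowness_minimum {c : ℝ} (a : ℝ) (hc : 0 < c) (s : ℝ) :
    HasDerivAt (fun a => slowness a c s) (-(3 / 2 * (s ^ 2 + 2 * a) * slowness a c s ^ 3)) a := by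
  have hpos := sqrt_radicand_pos a hc s
  have hrad : HasDerivAt (fun a => radicand a c s) (3 * (s ^ 2 + 2 * a)) a := by
    unfold radicand
    refine ((((((hasDerivAt_id' a).const_mul 3).mul_const (s ^ 2)).const_add (s ^ 4)).fun_add
      (((hasDerivAt_id' a).fun_pow 2).const_mul 3)).add_const (c / 2)).congr_deriv ?_
    push_cast; ring
  simp only [slowness, one_div]
  refine ((hrad.sqrt (radicand_pos a hc s).ne').fun_inv hpos.ne').congr_deriv ?_
  field_simp

theorem norm_deriv_slowness_minimum_le {c : ℝ} (a : ℝ) (hc : 0 < c) (s : ℝ) :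
    ‖-(3 / 2 * (s ^ 2 + 2 * a) * slowness a c s ^ 3)‖ ≤ 2 / √(c / 2) * slowness a c s := by
  have hpos := slowness_pos a hc s
  have hle : |3 / 2 * (s ^ 2 + 2 * a) * slowness a c s| ≤ 2 := by
    have hsq : slowness a c s ^ 2 * radicand a c s = 1 := by
      rw [slowness, div_pow, Real.sq_sqrt (radicand_pos a hc s).le, one_pow,
        one_div_mul_cancel (radicand_pos a hc s).ne']
    have hrad : 3 / 4 * (s ^ 2 + 2 * a) ^ 2 ≤ radicand a c s := by
      rw [radicand_eq_add_half]
      nlinarith [pow_nonneg (sq_nonneg s) 2]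
    refine abs_le_of_sq_le_sq ?_ zero_le_two
    nlinarith [sq_nonneg (slowness a c s)]
  calc ‖-(3 / 2 * (s ^ 2 + 2 * a) * slowness a c s ^ 3)‖
      = |3 / 2 * (s ^ 2 + 2 * a) * slowness a c s * slowness a c s * slowness a c s| := by
        rw [norm_neg, Real.norm_eq_abs]
        ring_nf
    _ = |3 / 2 * (s ^ 2 + 2 * a) * slowness a c s| * slowness a c s * slowness a c s := by
        rw [abs_mul, abs_mul, abs_of_pos hpos]
    _ ≤ 2 * (1 / √(c / 2)) * slowness a c s := by
        gcongr
        exact slowness_le_inv_sqrt_half a hc s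
    _ = 2 / √(c / 2) * slowness a c s := by rw [mul_one_div]

theorem hasDerivAt_blowupTime_minimum {c : ℝ} (a : ℝ) (hc : 0 < c) :
    Integrable (fun s => -(3 / 2 * (s ^ 2 + 2 * a) * slowness a c s ^ 3))
        (volume.restrict (Ioi 0)) ∧
      HasDerivAt (fun a => blowupTime a c)
        (∫ s in Ioi (0 : ℝ), -(3 / 2 * (s ^ 2 + 2 * a) * slowness a c s ^ 3)) a := by
  obtain ⟨K, hK⟩ := exists_slowness_le hc
  have hcont : Continuous fun s => -(3 / 2 * (s ^ 2 + 2 * a) * slowness a c s ^ 3) := by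
    have := continuous_slowness a hc
    fun_prop
  refine hasDerivAt_integral_of_dominated_loc_of_deriv_le (F := fun a s => slowness a c s)
    (bound := fun s => 2 / √(c / 2) * (K * (1 + s ^ 2)⁻¹)) univ_mem
    (Eventually.of_forall fun a => (continuous_slowness a hc).aestronglyMeasurable)
    (integrable_slowness a hc).integrableOn hcont.aestronglyMeasurable
    (Eventually.of_forall fun s b _ => ?_)
    ((integrable_inv_one_add_sq.const_mul K).const_mul _).integrableOn
    (Eventually.of_forall fun s b _ => hasDerivAt_slowness_minimum b hc s)
  refine (norm_deriv_slowness_minimum_le b hc s).trans ?_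
  gcongr
  exact hK b c s le_rfl

theorem setIntegral_deriv_slowness_minimum_neg {a c : ℝ} (ha : 0 ≤ a) (hc : 0 < c) :
    ∫ s in Ioi (0 : ℝ), -(3 / 2 * (s ^ 2 + 2 * a) * slowness a c s ^ 3) < 0 := by
  have hpos : ∀ s ∈ Ioi (0 : ℝ), 0 < 3 / 2 * (s ^ 2 + 2 * a) * slowness a c s ^ 3 := fun s hs => by
    have := slowness_pos a hc s
    have : 0 < s := hs
    positivity
  have hint := (hasDerivAt_blowupTime_minimum a hc).1.neg
  simp only [Pi.neg_def, neg_neg] at hint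
  rw [integral_neg, neg_lt_zero, setIntegral_pos_iff_support_of_nonneg_ae
    ((ae_restrict_iff' measurableSet_Ioi).2 (Eventually.of_forall fun s hs => (hpos s hs).le)) hint,
    inter_eq_right.2 fun s hs => Function.mem_support.2 (hpos s hs).ne']
  simp

theorem ellipticIntegral_eq_blowupTime (v : ℝ) : ellipticIntegral v = blowupTime v 1 := rfl

theorem exists_neg_forall_ellipticIntegral_le :
    ∃ v < 0, ∀ u, ellipticIntegral u ≤ ellipticIntegral v := by
  have hderiv := fun v => (hasDerivAt_blowupTime_minimum v one_pos).2
  obtain ⟨v, hv⟩ := exists_forall_le_of_tendsto_cocompact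
    (continuous_iff_continuousAt.2 fun v => (hderiv v).continuousAt)
    (blowupTime_pos 0 one_pos) (tendsto_blowupTime_cocompact one_pos)
  refine ⟨v, not_le.1 fun hv0 => (setIntegral_deriv_slowness_minimum_neg hv0 one_pos).ne ?_, hv⟩
  exact IsLocalMax.hasDerivAt_eq_zero (Eventually.of_forall hv) (hderiv v)

theorem isGreatest_C : IsGreatest (ellipticIntegral '' Iio 0) C := by
  obtain ⟨v, hv, hmax⟩ := exists_neg_forall_ellipticIntegral_le
  have h : IsGreatest (ellipticIntegral '' Iio 0) (ellipticIntegral v) :=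
    ⟨mem_image_of_mem _ hv, by rintro _ ⟨u, -, rfl⟩; exact hmax u⟩
  rwa [C, h.csSup_eq]

theorem ellipticIntegral_le_C (u : ℝ) : ellipticIntegral u ≤ C := by
  obtain ⟨v, hv, hmax⟩ := exists_neg_forall_ellipticIntegral_le
  exact (hmax u).trans (isGreatest_C.2 (mem_image_of_mem _ hv))

theorem exists_ellipticIntegral_eq_C : ∃ v, ellipticIntegral v = C := by
  obtain ⟨v, -, hv⟩ := isGreatest_C.1
  exact ⟨v, hv⟩

theorem C_pos : 0 < C := by
  obtain ⟨v, hv⟩ := exists_ellipticIntegral_eq_C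
  exact hv ▸ blowupTime_pos v one_pos

theorem blowupTime_scaling {r : ℝ} (hr : 0 < r) (v : ℝ) :
    blowupTime (r ^ 2 * v) (r ^ 4) = ellipticIntegral v / r := by
  have hscale : ∀ s, slowness (r ^ 2 * v) (r ^ 4) (r * s) = (r ^ 2)⁻¹ * slowness v 1 s := by
    intro s
    have : radicand (r ^ 2 * v) (r ^ 4) (r * s) = (r ^ 2) ^ 2 * radicand v 1 s := by
      unfold radicand; ring
    unfold slowness
    rw [this, Real.sqrt_mul (by positivity), Real.sqrt_sq (by positivity)]
    field_simp
  have hsubst := integral_comp_mul_left_Ioi' (slowness (r ^ 2 * v) (r ^ 4)) 0 hr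
  simp only [hscale, mul_zero, integral_const_mul, smul_eq_mul] at hsubst
  rw [blowupTime, ← hsubst, ellipticIntegral_eq_blowupTime, blowupTime]
  field_simp

theorem rpow_quarter_pow {c : ℝ} (hc : 0 ≤ c) : (c ^ (1 / 4 : ℝ)) ^ 4 = c := by
  rw [← Real.rpow_natCast, ← Real.rpow_mul hc]
  norm_num

theorem blowupTime_le {c : ℝ} (hc : 0 < c) (a : ℝ) : blowupTime a c ≤ C / c ^ (1 / 4 : ℝ) := by
  have hr := Real.rpow_pos_of_pos hc (1 / 4)
  have hscale := blowupTime_scaling hr (a / (c ^ (1 / 4 : ℝ)) ^ 2)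
  rw [mul_div_cancel₀ _ (by positivity), rpow_quarter_pow hc.le] at hscale
  rw [hscale]
  gcongr
  exact ellipticIntegral_le_C _

/-! ### Autonomous differential equations -/

section Autonomous

variable {E : Type*} [NormedAddCommGroup E] [NormedSpace ℝ E] {f : E → E}

theorem exists_uniform_existence_time [CompleteSpace E] (hf : ContDiff ℝ 1 f) {K : Set E}
    (hK : IsCompact K) :
    ∃ ε > 0, ∀ q ∈ K, ∀ t₀ : ℝ, ∃ α : ℝ → E, α t₀ = q ∧
      ∀ t ∈ Ioo (t₀ - ε) (t₀ + ε), HasDerivAt α (f (α t)) t := by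
  refine hK.induction_on (p := fun S => ∃ ε > 0, ∀ q ∈ S, ∀ t₀ : ℝ, ∃ α : ℝ → E, α t₀ = q ∧
    ∀ t ∈ Ioo (t₀ - ε) (t₀ + ε), HasDerivAt α (f (α t)) t) ⟨1, one_pos, by simp⟩ ?_ ?_ ?_
  · rintro S T hST ⟨ε, hε, h⟩
    exact ⟨ε, hε, fun q hq => h q (hST hq)⟩
  · rintro S T ⟨ε₁, hε₁, h₁⟩ ⟨ε₂, hε₂, h₂⟩
    refine ⟨min ε₁ ε₂, lt_min hε₁ hε₂, ?_⟩
    have hmono : ∀ {ε : ℝ}, min ε₁ ε₂ ≤ ε → ∀ t₀,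
        Ioo (t₀ - min ε₁ ε₂) (t₀ + min ε₁ ε₂) ⊆ Ioo (t₀ - ε) (t₀ + ε) := fun h t₀ =>
      Ioo_subset_Ioo (by linarith) (by linarith)
    rintro q (hq | hq) t₀
    · obtain ⟨α, hα₀, hα⟩ := h₁ q hq t₀
      exact ⟨α, hα₀, fun t ht => hα t (hmono (min_le_left _ _) t₀ ht)⟩
    · obtain ⟨α, hα₀, hα⟩ := h₂ q hq t₀
      exact ⟨α, hα₀, fun t ht => hα t (hmono (min_le_right _ _) t₀ ht)⟩
  · intro q _
    obtain ⟨r, hr, ε, hε, h⟩ := (hf.contDiffAt (x := q))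
      |>.exists_forall_mem_closedBall_exists_eq_forall_mem_Ioo_hasDerivAt 0
    refine ⟨_, mem_nhdsWithin_of_mem_nhds (Metric.closedBall_mem_nhds q hr), ε, hε,
      fun p hp t₀ => ?_⟩
    obtain ⟨α, hα₀, hα⟩ := h p hp
    exact ⟨fun t => α (t - t₀), by simp [hα₀], fun t ht =>
      (hα (t - t₀) ⟨by linarith [ht.1], by linarith [ht.2]⟩).comp_sub_const t t₀⟩

theorem eqOn_of_hasDerivAt_of_isPreconnected (hf : ContDiff ℝ 1 f) {U : Set ℝ} (hU : IsOpen U)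
    (hU' : IsPreconnected U) {α β : ℝ → E} (hα : ∀ t ∈ U, HasDerivAt α (f (α t)) t)
    (hβ : ∀ t ∈ U, HasDerivAt β (f (β t)) t) {t₀ : ℝ} (ht₀ : t₀ ∈ U) (h₀ : α t₀ = β t₀) :
    EqOn α β U := by
  have hlocal : ∀ t ∈ U, α t = β t → α =ᶠ[𝓝 t] β := by
    intro t ht heq
    obtain ⟨K, S, hS, hlip⟩ := (hf.contDiffAt (x := α t)).exists_lipschitzOnWith
    refine ODE_solution_unique_of_eventually (v := fun _ => f) (s := fun _ => S)
      (Eventually.of_forall fun _ => hlip) ?_ ?_ heq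
    · filter_upwards [hU.mem_nhds ht, (hα t ht).continuousAt hS] with τ hτ hτS
      exact ⟨hα τ hτ, hτS⟩
    · filter_upwards [hU.mem_nhds ht, (hβ t ht).continuousAt (heq ▸ hS)] with τ hτ hτS
      exact ⟨hβ τ hτ, hτS⟩
  have hsub : U ⊆ {t | α =ᶠ[𝓝 t] β} := by
    refine hU'.subset_of_closure_inter_subset isOpen_setOfPred_eventually_nhds
      ⟨t₀, ht₀, hlocal t₀ ht₀ h₀⟩ fun t ⟨htcl, htU⟩ => hlocal t htU ?_
    exact tendsto_nhds_unique_of_frequently_eq (hα t htU).continuousAt (hβ t htU).continuousAt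
      ((mem_closure_iff_frequently.1 htcl).mono fun _ h => h.self_of_nhds)
  exact fun t ht => (hsub ht).self_of_nhds

end Autonomous

/-! ### Solutions of the first Painlevé equation -/

/-- The first Painlevé equation as an autonomous first-order system for `(x, y, y')`. -/
def vectorField (q : ℝ × ℝ × ℝ) : ℝ × ℝ × ℝ := (1, q.2.2, 6 * q.2.1 ^ 2 - q.1)

theorem contDiff_vectorField : ContDiff ℝ 1 vectorField := by
  unfold vectorField; fun_prop

namespace IsSolution

variable {y z : ℝ → ℝ} {I J : Set ℝ}

theorem continuousOn (h : IsSolution y I) : ContinuousOn y I :=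
  HasDerivAt.continuousOn h.hasDerivAt

theorem continuousOn_deriv (h : IsSolution y I) : ContinuousOn (deriv y) I :=
  HasDerivAt.continuousOn h.hasDerivAt_deriv

theorem of_hasDerivAt {p : ℝ → ℝ} (hI : IsOpen I) (hI' : I.OrdConnected)
    (hy : ∀ x ∈ I, HasDerivAt y (p x) x) (hp : ∀ x ∈ I, HasDerivAt p (6 * y x ^ 2 - x) x) :
    IsSolution y I where
  isOpen := hI
  ordConnected := hI'
  hasDerivAt x hx := (hy x hx).differentiableAt.hasDerivAt
  hasDerivAt_deriv x hx := (hp x hx).congr_of_eventuallyEq <| by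
    filter_upwards [hI.mem_nhds hx] with t ht using (hy t ht).deriv

theorem of_forall_eventuallyEq (hI : IsOpen I) (hI' : I.OrdConnected)
    (h : ∀ x ∈ I, ∃ (z : ℝ → ℝ) (J : Set ℝ), IsSolution z J ∧ x ∈ J ∧ y =ᶠ[𝓝 x] z) :
    IsSolution y I where
  isOpen := hI
  ordConnected := hI'
  hasDerivAt x hx := by
    obtain ⟨z, J, hz, hxJ, hyz⟩ := h x hx
    exact ((hz.hasDerivAt x hxJ).congr_of_eventuallyEq hyz).differentiableAt.hasDerivAt
  hasDerivAt_deriv x hx := by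
    obtain ⟨z, J, hz, hxJ, hyz⟩ := h x hx
    rw [hyz.self_of_nhds]
    exact (hz.hasDerivAt_deriv x hxJ).congr_of_eventuallyEq hyz.deriv

theorem hasDerivAt_phase (h : IsSolution y I) {x : ℝ} (hx : x ∈ I) :
    HasDerivAt (fun x => (x, y x, deriv y x)) (vectorField (x, y x, deriv y x)) x :=
  (hasDerivAt_id' x).prodMk ((h.hasDerivAt x hx).prodMk (h.hasDerivAt_deriv x hx))

theorem eqOn_inter (hy : IsSolution y I) (hz : IsSolution z J) {x₀ : ℝ} (hI : x₀ ∈ I)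
    (hJ : x₀ ∈ J) (h0 : y x₀ = z x₀) (h1 : deriv y x₀ = deriv z x₀) : EqOn y z (I ∩ J) := by
  have hphase := eqOn_of_hasDerivAt_of_isPreconnected contDiff_vectorField
    (hy.isOpen.inter hz.isOpen) (hy.ordConnected.inter hz.ordConnected).isPreconnected
    (fun x hx => hy.hasDerivAt_phase hx.1) (fun x hx => hz.hasDerivAt_phase hx.2)
    ⟨hI, hJ⟩ (by rw [h0, h1])
  exact fun x hx => congrArg (fun q => q.2.1) (hphase hx)

theorem eventuallyEq (h : IsSolution y I) (hzy : EqOn z y I) {x : ℝ} (hx : x ∈ I) :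
    z =ᶠ[𝓝 x] y :=
  hzy.eventuallyEq_of_mem (h.isOpen.mem_nhds hx)

end IsSolution

theorem exists_isSolution_iUnion {ι : Type*} {z : ι → ℝ → ℝ} {D : ι → Set ℝ} {x₀ y₀ y₁ : ℝ}
    (hz : ∀ i, IsSolution (z i) (D i)) (hx₀ : ∀ i, x₀ ∈ D i) (h0 : ∀ i, z i x₀ = y₀)
    (h1 : ∀ i, deriv (z i) x₀ = y₁) :
    ∃ y, IsSolution y (⋃ i, D i) ∧ ∀ i, EqOn y (z i) (D i) := by
  classical
  let y : ℝ → ℝ := fun x => if h : ∃ i, x ∈ D i then z h.choose x else 0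
  have hyz : ∀ i, EqOn y (z i) (D i) := fun i x hx => by
    have h : ∃ i, x ∈ D i := ⟨i, hx⟩
    have hy : y x = z h.choose x := dif_pos h
    rw [hy]
    exact (hz _).eqOn_inter (hz i) (hx₀ _) (hx₀ i) ((h0 _).trans (h0 i).symm)
      ((h1 _).trans (h1 i).symm) ⟨h.choose_spec, hx⟩
  have hconn : IsPreconnected (⋃ i, D i) :=
    isPreconnected_iUnion ⟨x₀, mem_iInter.2 hx₀⟩ fun i => (hz i).ordConnected.isPreconnected
  refine ⟨y, .of_forall_eventuallyEq (isOpen_iUnion fun i => (hz i).isOpen) hconn.ordConnected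
    fun x hx => ?_, hyz⟩
  obtain ⟨i, hi⟩ := mem_iUnion.1 hx
  exact ⟨z i, D i, hz i, hi, (hz i).eventuallyEq (hyz i) hi⟩

theorem exists_isSolution_of_isCompact {K : Set (ℝ × ℝ × ℝ)} (hK : IsCompact K) :
    ∃ ε > 0, ∀ t a b : ℝ, (t, a, b) ∈ K →
      ∃ z, IsSolution z (Ioo (t - ε) (t + ε)) ∧ z t = a ∧ deriv z t = b := by
  obtain ⟨ε, hε, hex⟩ := exists_uniform_existence_time contDiff_vectorField hK
  refine ⟨ε, hε, fun t a b hq => ?_⟩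
  obtain ⟨α, hα₀, hα⟩ := hex _ hq t
  have ht : t ∈ Ioo (t - ε) (t + ε) := ⟨by linarith, by linarith⟩
  have hfst : ∀ x ∈ Ioo (t - ε) (t + ε), HasDerivAt (fun x => (α x).1) 1 x :=
    fun x hx => (hα x hx).fst
  have hpos : ∀ x ∈ Ioo (t - ε) (t + ε), HasDerivAt (fun x => (α x).2.1) (α x).2.2 x :=
    fun x hx => (hα x hx).snd.fst
  have hvel : ∀ x ∈ Ioo (t - ε) (t + ε),
      HasDerivAt (fun x => (α x).2.2) (6 * (α x).2.1 ^ 2 - (α x).1) x :=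
    fun x hx => (hα x hx).snd.snd
  have htime : EqOn (fun x => (α x).1) id (Ioo (t - ε) (t + ε)) :=
    isOpen_Ioo.eqOn_of_deriv_eq isPreconnected_Ioo
      (fun x hx => (hfst x hx).differentiableAt.differentiableWithinAt) differentiableOn_id
      (fun x hx => by simp [(hfst x hx).deriv]) ht (by simp [hα₀])
  refine ⟨fun x => (α x).2.1, .of_hasDerivAt isOpen_Ioo ordConnected_Ioo hpos fun x hx => ?_,
    by simp [hα₀], by simp [(hpos t ht).deriv, hα₀]⟩
  have hx' : (α x).1 = x := htime hx
  simpa only [hx'] using hvel x hx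

theorem IsSolution.exists_union {y z : ℝ → ℝ} {I J : Set ℝ} (hy : IsSolution y I)
    (hz : IsSolution z J) {x₀ : ℝ} (hI : x₀ ∈ I) (hJ : x₀ ∈ J) (h0 : z x₀ = y x₀)
    (h1 : deriv z x₀ = deriv y x₀) : ∃ w, IsSolution w (I ∪ J) ∧ EqOn w y I := by
  rw [union_eq_iUnion]
  obtain ⟨w, hw, heq⟩ := exists_isSolution_iUnion (z := fun b => cond b y z)
    (D := fun b => cond b I J) (Bool.forall_bool.2 ⟨hz, hy⟩) (Bool.forall_bool.2 ⟨hJ, hI⟩)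
    (Bool.forall_bool.2 ⟨h0, rfl⟩) (Bool.forall_bool.2 ⟨h1, rfl⟩)
  exact ⟨w, hw, heq true⟩

theorem exists_isMaximalSolution (x₀ y₀ y₁ : ℝ) :
    ∃ (y : ℝ → ℝ) (I : Set ℝ), IsMaximalSolution y I ∧ x₀ ∈ I ∧ y x₀ = y₀ ∧ deriv y x₀ = y₁ := by
  let ι := {p : (ℝ → ℝ) × Set ℝ //
    IsSolution p.1 p.2 ∧ x₀ ∈ p.2 ∧ p.1 x₀ = y₀ ∧ deriv p.1 x₀ = y₁}
  obtain ⟨y, hy, heq⟩ := exists_isSolution_iUnion (fun i : ι => i.2.1) (fun i => i.2.2.1)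
    (fun i => i.2.2.2.1) fun i => i.2.2.2.2
  obtain ⟨ε, hε, hloc⟩ := exists_isSolution_of_isCompact (isCompact_singleton (x := (x₀, y₀, y₁)))
  obtain ⟨z, hz, h0, h1⟩ := hloc x₀ y₀ y₁ rfl
  let i : ι := ⟨(z, Ioo (x₀ - ε) (x₀ + ε)), hz, ⟨by linarith, by linarith⟩, h0, h1⟩
  have hyz := hz.eventuallyEq (heq i) i.2.2.1
  have hx₀ : x₀ ∈ ⋃ j : ι, j.1.2 := mem_iUnion.2 ⟨i, i.2.2.1⟩
  have hy0 : y x₀ = y₀ := hyz.self_of_nhds.trans h0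
  have hy1 : deriv y x₀ = y₁ := hyz.deriv_eq.trans h1
  refine ⟨y, _, ⟨hy, fun w J hw hsub hwy => ?_⟩, hx₀, hy0, hy1⟩
  have hJ : J ⊆ ⋃ j : ι, j.1.2 := subset_iUnion (fun j : ι => j.1.2)
    ⟨(w, J), hw, hsub hx₀, (hwy hx₀).trans hy0, (hy.eventuallyEq hwy hx₀).deriv_eq.trans hy1⟩
  exact hJ.antisymm hsub

/-- Solutions through the points of a compact set exist for a uniform time, so `y` extends past
every `β ≤ x₀` in the closure of `I`. -/
theorem IsMaximalSolution.mem_of_bounded {y : ℝ → ℝ} {I : Set ℝ} (h : IsMaximalSolution y I)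
    {m x₀ B : ℝ} (hm : m ∈ I) (hmx : m ≤ x₀)
    (hB : ∀ t ∈ I, m ≤ t → t ≤ x₀ → |y t| ≤ B ∧ |deriv y t| ≤ B) : x₀ ∈ I := by
  obtain ⟨ε, hε, hloc⟩ := exists_isSolution_of_isCompact
    ((isCompact_Icc (a := m) (b := x₀)).prod
      ((isCompact_Icc (a := -B) (b := B)).prod (isCompact_Icc (a := -B) (b := B))))
  refine isPreconnected_Icc.subset_of_closure_inter_subset h.1.isOpen
    ⟨m, left_mem_Icc.2 hmx, hm⟩ (fun β ⟨hβ, hmβ, hβx⟩ => ?_) (right_mem_Icc.2 hmx)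
  obtain ⟨t, ht, hdist⟩ := Metric.mem_closure_iff.1 hβ ε hε
  rw [Real.dist_eq, abs_lt] at hdist
  rcases le_total β t with hβt | htβ
  · exact h.1.ordConnected.out hm ht ⟨hmβ, hβt⟩
  have hτ : max m t ∈ I := max_rec' (· ∈ I) hm ht
  have hτβ : max m t ≤ β := max_le hmβ htβ
  have htτ : t ≤ max m t := le_max_right m t
  obtain ⟨hy, hy'⟩ := hB _ hτ (le_max_left m t) (hτβ.trans hβx)
  obtain ⟨z, hz, h0, h1⟩ := hloc (max m t) _ _
    ⟨⟨le_max_left m t, hτβ.trans hβx⟩, abs_le.1 hy, abs_le.1 hy'⟩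
  obtain ⟨w, hw, hwy⟩ := h.1.exists_union hz hτ ⟨by linarith, by linarith⟩ h0 h1
  rw [← h.2 w _ hw subset_union_left hwy]
  exact Or.inr ⟨by linarith, by linarith⟩

/-! ### Comparison with a constant force -/

/-- The squared speed `2 ∫ u in a..b, (6 u ^ 2 + c)` that a solution of `y'' = 6 y ^ 2 + c`
starting at rest from `a` has when it reaches `b`. -/
def squaredSpeed (a c b : ℝ) : ℝ := 4 * (b ^ 3 - a ^ 3) + 2 * c * (b - a)

section Comparison

variable {a b c d u v : ℝ} {y p : ℝ → ℝ}

theorem squaredSpeed_self (a c : ℝ) : squaredSpeed a c a = 0 := by simp [squaredSpeed]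

theorem squaredSpeed_mono (hab : a ≤ b) (hcd : c ≤ d) :
    squaredSpeed a c b ≤ squaredSpeed a d b := by
  have : 0 ≤ b - a := sub_nonneg.2 hab
  unfold squaredSpeed
  gcongr

theorem squaredSpeed_eq_sq_mul_radicand (c : ℝ) (hab : a ≤ b) :
    squaredSpeed a c b = (2 * √(b - a)) ^ 2 * radicand a c √(b - a) := by
  have hsq : √(b - a) ^ 2 = b - a := Real.sq_sqrt (sub_nonneg.2 hab)
  have hquart : √(b - a) ^ 4 = (b - a) ^ 2 := (pow_mul √(b - a) 2 2).trans (by rw [hsq])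
  rw [squaredSpeed, radicand, mul_pow, hquart, hsq]
  ring

theorem squaredSpeed_pos (hc : 0 < c) (hab : a < b) : 0 < squaredSpeed a c b := by
  have := Real.sqrt_pos.2 (sub_pos.2 hab)
  have := radicand_pos a hc √(b - a)
  rw [squaredSpeed_eq_sq_mul_radicand c hab.le]
  positivity

theorem hasDerivAt_riseTime_sqrt {y' t : ℝ} (hc : 0 < c) (hy : HasDerivAt y y' t)
    (ha : a < y t) :
    HasDerivAt (fun t => riseTime a c √(y t - a)) (y' / √(squaredSpeed a c (y t))) t := by
  have hpos : 0 < y t - a := sub_pos.2 ha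
  have := sqrt_radicand_pos a hc √(y t - a)
  refine ((hasDerivAt_riseTime a hc √(y t - a)).comp t
    ((hy.sub_const a).sqrt hpos.ne')).congr_deriv ?_
  rw [squaredSpeed_eq_sq_mul_radicand c ha.le, Real.sqrt_mul (by positivity),
    Real.sqrt_sq (by positivity), slowness]
  field_simp

theorem continuousOn_riseTime_sqrt {s : Set ℝ} (a : ℝ) (hc : 0 < c) (hy : ContinuousOn y s) :
    ContinuousOn (fun t => riseTime a c √(y t - a)) s :=
  (continuous_iff_continuousAt.2 fun s => (hasDerivAt_riseTime a hc s).continuousAt)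
    |>.comp_continuousOn (hy.sub continuousOn_const).sqrt

theorem sub_le_riseTime_sub (hc : 0 < c) (huv : u ≤ v) (hcont : ContinuousOn y (Icc u v))
    (hy : ∀ t ∈ Ioo u v, HasDerivAt y (p t) t) (ha : ∀ t ∈ Ioo u v, a < y t)
    (hp : ∀ t ∈ Ioo u v, √(squaredSpeed a c (y t)) ≤ p t) :
    v - u ≤ riseTime a c √(y v - a) - riseTime a c √(y u - a) := by
  have hd : ∀ t ∈ interior (Icc u v), HasDerivAt (fun t => riseTime a c √(y t - a))
      (p t / √(squaredSpeed a c (y t))) t := by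
    rw [interior_Icc]
    exact fun t ht => hasDerivAt_riseTime_sqrt hc (hy t ht) (ha t ht)
  have hspeed : ∀ t ∈ interior (Icc u v), 1 ≤ deriv (fun t => riseTime a c √(y t - a)) t := by
    intro t ht
    rw [(hd t ht).deriv]
    rw [interior_Icc] at ht
    exact (one_le_div (Real.sqrt_pos.2 (squaredSpeed_pos hc (ha t ht)))).2 (hp t ht)
  simpa only [one_mul] using (convex_Icc u v).mul_sub_le_image_sub_of_le_deriv
    (continuousOn_riseTime_sqrt a hc hcont)
    (fun t ht => (hd t ht).differentiableAt.differentiableWithinAt) hspeed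
    u (left_mem_Icc.2 huv) v (right_mem_Icc.2 huv) huv

theorem riseTime_sub_le_sub (hc : 0 < c) (huv : u ≤ v) (hcont : ContinuousOn y (Icc u v))
    (hy : ∀ t ∈ Ioo u v, HasDerivAt y (p t) t) (ha : ∀ t ∈ Ioo u v, a < y t)
    (hp : ∀ t ∈ Ioo u v, p t ≤ √(squaredSpeed a c (y t))) :
    riseTime a c √(y v - a) - riseTime a c √(y u - a) ≤ v - u := by
  have hd : ∀ t ∈ interior (Icc u v), HasDerivAt (fun t => riseTime a c √(y t - a))
      (p t / √(squaredSpeed a c (y t))) t := by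
    rw [interior_Icc]
    exact fun t ht => hasDerivAt_riseTime_sqrt hc (hy t ht) (ha t ht)
  have hspeed : ∀ t ∈ interior (Icc u v), deriv (fun t => riseTime a c √(y t - a)) t ≤ 1 := by
    intro t ht
    rw [(hd t ht).deriv]
    rw [interior_Icc] at ht
    exact div_le_one_of_le₀ (hp t ht) (Real.sqrt_nonneg _)
  simpa only [one_mul] using (convex_Icc u v).image_sub_le_mul_sub_of_deriv_le
    (continuousOn_riseTime_sqrt a hc hcont)
    (fun t ht => (hd t ht).differentiableAt.differentiableWithinAt) hspeed
    u (left_mem_Icc.2 huv) v (right_mem_Icc.2 huv) huv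

end Comparison

namespace IsSolution

variable {y : ℝ → ℝ} {I : Set ℝ} {m t : ℝ}

theorem strictMonoOn_deriv (h : IsSolution y I) {s : Set ℝ} (hs : s ⊆ I) (hs' : s.OrdConnected)
    (hneg : s ⊆ Iic 0) : StrictMonoOn (deriv y) s := by
  refine strictMonoOn_of_deriv_pos hs'.convex (h.continuousOn_deriv.mono hs) fun x hx => ?_
  rw [(h.hasDerivAt_deriv x (hs (interior_subset hx))).deriv]
  have hx0 : x < 0 := by simpa using interior_mono hneg hx
  linarith [sq_nonneg (y x)]

theorem deriv_pos_of_lt (h : IsSolution y I) (hm : m ∈ I) (h0 : deriv y m = 0) (ht : t ∈ I)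
    (hmt : m < t) (ht0 : t ≤ 0) : 0 < deriv y t := by
  rw [← h0]
  exact h.strictMonoOn_deriv (h.ordConnected.out hm ht) ordConnected_Icc
    (fun x hx => hx.2.trans ht0) (left_mem_Icc.2 hmt.le) (right_mem_Icc.2 hmt.le) hmt

theorem deriv_nonneg_of_le (h : IsSolution y I) (hm : m ∈ I) (h0 : deriv y m = 0) (ht : t ∈ I)
    (hmt : m ≤ t) (ht0 : t ≤ 0) : 0 ≤ deriv y t := by
  rcases hmt.eq_or_lt with rfl | hmt
  · exact h0.ge
  · exact (h.deriv_pos_of_lt hm h0 ht hmt ht0).le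

theorem lt_apply_of_lt (h : IsSolution y I) (hm : m ∈ I) (h0 : deriv y m = 0) (ht : t ∈ I)
    (hmt : m < t) (ht0 : t ≤ 0) : y m < y t := by
  have hsub := h.ordConnected.out hm ht
  refine strictMonoOn_of_deriv_pos (convex_Icc m t) (h.continuousOn.mono hsub) (fun x hx => ?_)
    (left_mem_Icc.2 hmt.le) (right_mem_Icc.2 hmt.le) hmt
  rw [interior_Icc] at hx
  exact h.deriv_pos_of_lt hm h0 (hsub (Ioo_subset_Icc_self hx)) hx.1 (hx.2.le.trans ht0)

theorem le_apply_of_le (h : IsSolution y I) (hm : m ∈ I) (h0 : deriv y m = 0) (ht : t ∈ I)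
    (hmt : m ≤ t) (ht0 : t ≤ 0) : y m ≤ y t := by
  rcases hmt.eq_or_lt with rfl | hmt
  · exact le_rfl
  · exact (h.lt_apply_of_lt hm h0 ht hmt ht0).le

theorem sub_le_mul_deriv (h : IsSolution y I) (hm : m ∈ I) (ht : t ∈ I) (hmt : m ≤ t)
    (ht0 : t ≤ 0) : y t - y m ≤ (t - m) * deriv y t := by
  have hsub := h.ordConnected.out hm ht
  have hmono := h.strictMonoOn_deriv hsub ordConnected_Icc fun x hx => hx.2.trans ht0
  rw [mul_comm]
  refine (convex_Icc m t).image_sub_le_mul_sub_of_deriv_le (h.continuousOn.mono hsub)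
    (fun x hx => (h.hasDerivAt x (hsub (interior_subset hx))).differentiableAt
      |>.differentiableWithinAt) (fun x hx => ?_)
    m (left_mem_Icc.2 hmt) t (right_mem_Icc.2 hmt) hmt
  have hx := interior_subset hx
  exact hmono.monotoneOn hx (right_mem_Icc.2 hmt) hx.2

theorem isMinOn_of_deriv_eq_zero (h : IsSolution y I) {x₀ : ℝ} (hm : m ∈ I)
    (h0 : deriv y m = 0) (hmx : m ≤ x₀) (hx₀ : x₀ ≤ 0) : IsMinOn y (I ∩ Iic x₀) m := by
  rintro t ⟨ht, htx⟩
  rcases le_total m t with hmt | htm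
  · exact h.le_apply_of_le hm h0 ht hmt (le_trans htx hx₀)
  have hsub := h.ordConnected.out ht hm
  have hmono := h.strictMonoOn_deriv hsub ordConnected_Icc fun x hx => hx.2.trans (hmx.trans hx₀)
  refine antitoneOn_of_deriv_nonpos (convex_Icc t m) (h.continuousOn.mono hsub)
    (fun x hx => (h.hasDerivAt x (hsub (interior_subset hx))).differentiableAt
      |>.differentiableWithinAt) (fun x hx => ?_)
    (left_mem_Icc.2 htm) (right_mem_Icc.2 htm) htm
  have hx := interior_subset hx
  exact (hmono.monotoneOn hx (right_mem_Icc.2 htm) hx.2).trans_eq h0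

theorem hasDerivAt_sq_deriv_sub_squaredSpeed (h : IsSolution y I) (ht : t ∈ I) {k : ℝ → ℝ}
    {k' : ℝ} (hk : HasDerivAt k k' t) (a : ℝ) :
    HasDerivAt (fun t => deriv y t ^ 2 - squaredSpeed a (k t) (y t))
      (-(2 * (k t + t) * deriv y t) - 2 * k' * (y t - a)) t := by
  have hy := h.hasDerivAt t ht
  unfold squaredSpeed
  refine (((h.hasDerivAt_deriv t ht).fun_pow 2).fun_sub
    ((((hy.fun_pow 3).sub_const (a ^ 3)).const_mul 4).fun_add
      ((hk.const_mul 2).fun_mul (hy.sub_const a)))).congr_deriv ?_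
  push_cast; ring

theorem squaredSpeed_le_sq_deriv (h : IsSolution y I) (hm : m ∈ I) (h0 : deriv y m = 0) {p : ℝ}
    (hp : p ∈ I) (hmt : m ≤ t) (htp : t ≤ p) (hp0 : p ≤ 0) :
    squaredSpeed (y m) (-p) (y t) ≤ deriv y t ^ 2 := by
  have hsub := h.ordConnected.out hm hp
  have hd : ∀ x ∈ Icc m p, HasDerivAt (fun x => deriv y x ^ 2 - squaredSpeed (y m) (-p) (y x))
      (2 * (p - x) * deriv y x) x := fun x hx =>
    (h.hasDerivAt_sq_deriv_sub_squaredSpeed (hsub hx) (hasDerivAt_const x (-p)) _).congr_deriv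
      (by ring)
  have hmono : MonotoneOn (fun x => deriv y x ^ 2 - squaredSpeed (y m) (-p) (y x)) (Icc m p) := by
    refine monotoneOn_of_deriv_nonneg (convex_Icc m p) (HasDerivAt.continuousOn hd)
      (fun x hx => (hd x (interior_subset hx)).differentiableAt.differentiableWithinAt)
      fun x hx => ?_
    have hx := interior_subset hx
    rw [(hd x hx).deriv]
    have := h.deriv_nonneg_of_le hm h0 (hsub hx) hx.1 (hx.2.trans hp0)
    have : 0 ≤ p - x := sub_nonneg.2 hx.2
    positivity
  simpa [h0, squaredSpeed_self] using hmono ⟨le_rfl, hmt.trans htp⟩ ⟨hmt, htp⟩ hmt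

/-- By convexity of `y`, the average of the force `-x` over the rise from `y m` to `y t`, weighted
by `dy`, is at most its average `-(m + t) / 2` over time. -/
theorem sq_deriv_le_squaredSpeed (h : IsSolution y I) (hm : m ∈ I) (h0 : deriv y m = 0)
    (ht : t ∈ I) (hmt : m ≤ t) (ht0 : t ≤ 0) {c : ℝ} (hc : -(m + t) / 2 ≤ c) :
    deriv y t ^ 2 ≤ squaredSpeed (y m) c (y t) := by
  have hsub := h.ordConnected.out hm ht
  have hd : ∀ x ∈ Icc m t,
      HasDerivAt (fun x => deriv y x ^ 2 - squaredSpeed (y m) (-(m + x) / 2) (y x))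
        (y x - y m - (x - m) * deriv y x) x := fun x hx =>
    (h.hasDerivAt_sq_deriv_sub_squaredSpeed (hsub hx)
      (((hasDerivAt_id' x).const_add m).fun_neg.div_const 2) _).congr_deriv (by ring)
  have hanti : AntitoneOn (fun x => deriv y x ^ 2 - squaredSpeed (y m) (-(m + x) / 2) (y x))
      (Icc m t) := by
    refine antitoneOn_of_deriv_nonpos (convex_Icc m t) (HasDerivAt.continuousOn hd)
      (fun x hx => (hd x (interior_subset hx)).differentiableAt.differentiableWithinAt)
      fun x hx => ?_
    have hx := interior_subset hx
    rw [(hd x hx).deriv]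
    linarith [h.sub_le_mul_deriv hm (hsub hx) hx.1 (hx.2.trans ht0)]
  have hle : deriv y t ^ 2 ≤ squaredSpeed (y m) (-(m + t) / 2) (y t) := by
    simpa [h0, squaredSpeed_self] using hanti ⟨le_rfl, hmt⟩ ⟨hmt, le_rfl⟩ hmt
  exact hle.trans (squaredSpeed_mono (h.le_apply_of_le hm h0 ht hmt ht0) hc)

variable {u v : ℝ}

theorem sub_le_riseTime_sub (h : IsSolution y I) (hm : m ∈ I) (h0 : deriv y m = 0) (hv : v ∈ I)
    (hmu : m ≤ u) (huv : u ≤ v) (hv0 : v < 0) :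
    v - u ≤ riseTime (y m) (-v) √(y v - y m) - riseTime (y m) (-v) √(y u - y m) := by
  have hsub : Icc u v ⊆ I := (Icc_subset_Icc_left hmu).trans (h.ordConnected.out hm hv)
  have hI : ∀ t ∈ Ioo u v, t ∈ I := fun t ht => hsub (Ioo_subset_Icc_self ht)
  refine PainleveOne.sub_le_riseTime_sub (neg_pos.2 hv0) huv (h.continuousOn.mono hsub)
    (fun t ht => h.hasDerivAt t (hI t ht))
    (fun t ht => h.lt_apply_of_lt hm h0 (hI t ht) (hmu.trans_lt ht.1) (ht.2.trans hv0).le)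
    fun t ht => ?_
  have hmt : m ≤ t := hmu.trans ht.1.le
  exact Real.sqrt_le_iff.2 ⟨h.deriv_nonneg_of_le hm h0 (hI t ht) hmt (ht.2.trans hv0).le,
    h.squaredSpeed_le_sq_deriv hm h0 hv hmt ht.2.le hv0.le⟩

theorem riseTime_sub_le_sub (h : IsSolution y I) (hm : m ∈ I) (h0 : deriv y m = 0) (hv : v ∈ I)
    (hmu : m ≤ u) (huv : u ≤ v) (hv0 : v ≤ 0) {c : ℝ} (hc : 0 < c) (hcu : -(m + u) / 2 ≤ c) :
    riseTime (y m) c √(y v - y m) - riseTime (y m) c √(y u - y m) ≤ v - u := by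
  have hsub : Icc u v ⊆ I := (Icc_subset_Icc_left hmu).trans (h.ordConnected.out hm hv)
  have hI : ∀ t ∈ Ioo u v, t ∈ I := fun t ht => hsub (Ioo_subset_Icc_self ht)
  refine PainleveOne.riseTime_sub_le_sub hc huv (h.continuousOn.mono hsub)
    (fun t ht => h.hasDerivAt t (hI t ht))
    (fun t ht => h.lt_apply_of_lt hm h0 (hI t ht) (hmu.trans_lt ht.1) (ht.2.le.trans hv0))
    fun t ht => Real.le_sqrt_of_sq_le ?_
  exact h.sq_deriv_le_squaredSpeed hm h0 (hI t ht) (hmu.trans ht.1.le) (ht.2.le.trans hv0)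
    (by linarith [ht.1])

end IsSolution

/-! ### The lower bound -/

theorem le_of_mem_minPoints {x₀ m : ℝ} (hm : m ∈ minPoints x₀) : m ≤ x₀ := by
  obtain ⟨_, _, -, _, _, -, -, -, -, hmI, -⟩ := hm
  exact hmI.2

theorem exists_isSolution_of_mem_minPoints {x₀ m : ℝ} (hm : m ∈ minPoints x₀) (hlt : m < x₀) :
    ∃ (y : ℝ → ℝ) (I : Set ℝ), IsSolution y I ∧ m ∈ I ∧ x₀ ∈ I ∧ deriv y m = 0 := by
  obtain ⟨_, _, -, y, I, hmax, hx₀, -, -, hmI, hmin⟩ := hm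
  have hnhds : I ∩ Iic x₀ ∈ 𝓝 m := inter_mem (hmax.1.isOpen.mem_nhds hmI.1) (Iic_mem_nhds hlt)
  exact ⟨y, I, hmax.1, hmI.1, hx₀, (hmin.isLocalMin hnhds).deriv_eq_zero⟩

namespace IsSolution

variable {y : ℝ → ℝ} {I : Set ℝ} {m p x : ℝ}

theorem sub_mul_sqrt_le_sqrt_sub (h : IsSolution y I) (hm : m ∈ I) (h0 : deriv y m = 0)
    (hp : p ∈ I) (hmp : m ≤ p) (hp0 : p < 0) : (p - m) * √(-p / 2) ≤ √(y p - y m) := by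
  have hpos : 0 < -p := neg_pos.2 hp0
  have htime := h.sub_le_riseTime_sub hm h0 hp le_rfl hmp hp0
  rw [sub_self (y m), Real.sqrt_zero, riseTime_zero, sub_zero] at htime
  have := htime.trans (riseTime_le_div (y m) hpos (Real.sqrt_nonneg _))
  rwa [le_div_iff₀ (Real.sqrt_pos.2 (half_pos hpos))] at this

theorem sub_lt_twoStageBlowupTime (h : IsSolution y I) (hm : m ∈ I) (h0 : deriv y m = 0)
    (hx : x ∈ I) (hmp : m ≤ p) (hpx : p ≤ x) (hx0 : x < 0) :
    x - m < twoStageBlowupTime (y m) (-p) (-x) √(y p - y m) := by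
  have hp : p ∈ I := h.ordConnected.out hm hx ⟨hmp, hpx⟩
  have hfirst := h.sub_le_riseTime_sub hm h0 hp le_rfl hmp (hpx.trans_lt hx0)
  rw [sub_self (y m), Real.sqrt_zero, riseTime_zero, sub_zero] at hfirst
  have hsecond := h.sub_le_riseTime_sub hm h0 hx hmp hpx hx0
  have := riseTime_lt_blowupTime (y m) (neg_pos.2 hx0) √(y x - y m)
  unfold twoStageBlowupTime
  linarith

end IsSolution

/-- A quarter of the time `T = C / |x₀| ^ (1 / 4)` suffices to climb a height that depends only on
`x₀`, and the stronger force acting during that time brings the blow-up uniformly ahead of `T`. -/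
theorem exists_gt_forall_le_of_deriv_eq_zero {x₀ : ℝ} (hx₀ : x₀ < 0) :
    ∃ b > x₀ - C / |x₀| ^ (1 / 4 : ℝ), b ≤ x₀ ∧ ∀ (y : ℝ → ℝ) (I : Set ℝ) (m : ℝ),
      IsSolution y I → m ∈ I → x₀ ∈ I → deriv y m = 0 → b ≤ m := by
  have hc : 0 < -x₀ := neg_pos.2 hx₀
  rw [abs_of_neg hx₀]
  obtain ⟨T, hT⟩ : ∃ T, T = C / (-x₀) ^ (1 / 4 : ℝ) := ⟨_, rfl⟩
  have hTpos : 0 < T := hT ▸ div_pos C_pos (Real.rpow_pos_of_pos hc _)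
  obtain ⟨p, hp⟩ : ∃ p, p = x₀ - T / 4 := ⟨_, rfl⟩
  have hd : 0 < -p := by linarith
  have hcd : -x₀ < -p := by linarith
  obtain ⟨δ, hδ⟩ : ∃ δ, δ = T / 4 * √(-p / 2) := ⟨_, rfl⟩
  have hδpos : 0 < δ := hδ ▸ mul_pos (by positivity) (Real.sqrt_pos.2 (half_pos hd))
  obtain ⟨a, ha⟩ := exists_forall_twoStageBlowupTime_le hc hd hδpos.le
  have haT : twoStageBlowupTime a (-p) (-x₀) δ < T :=
    (twoStageBlowupTime_lt_blowupTime hc hcd hδpos).trans_le (hT ▸ blowupTime_le hc a)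
  rw [← hT]
  refine ⟨x₀ - max (T / 2) (twoStageBlowupTime a (-p) (-x₀) δ),
    sub_lt_sub_left (max_lt (half_lt_self hTpos) haT) _,
    sub_le_self _ ((half_pos hTpos).le.trans (le_max_left _ _)), fun y I m hy hm hx h0 => ?_⟩
  rcases le_or_gt (x₀ - T / 2) m with hmT | hmT
  · linarith [le_max_left (T / 2) (twoStageBlowupTime a (-p) (-x₀) δ)]
  have hmp : m ≤ p := by linarith
  have hpx : p ≤ x₀ := by linarith
  have hheight : δ ≤ √(y p - y m) := by
    refine le_trans ?_ (hy.sub_mul_sqrt_le_sqrt_sub hm h0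
      (hy.ordConnected.out hm hx ⟨hmp, hpx⟩) hmp (by linarith))
    rw [hδ]
    gcongr
    linarith
  have htime : x₀ - m ≤ twoStageBlowupTime a (-p) (-x₀) δ :=
    calc x₀ - m ≤ twoStageBlowupTime (y m) (-p) (-x₀) √(y p - y m) :=
          (hy.sub_lt_twoStageBlowupTime hm h0 hx hmp hpx hx₀).le
      _ ≤ twoStageBlowupTime (y m) (-p) (-x₀) δ := antitone_twoStageBlowupTime hc hcd hheight
      _ ≤ twoStageBlowupTime a (-p) (-x₀) δ := ha (y m)
  linarith [le_max_right (T / 2) (twoStageBlowupTime a (-p) (-x₀) δ)]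

theorem exists_gt_forall_mem_minPoints_le {x₀ : ℝ} (hx₀ : x₀ < 0) :
    ∃ b > x₀ - C / |x₀| ^ (1 / 4 : ℝ), ∀ m ∈ minPoints x₀, b ≤ m := by
  obtain ⟨b, hb, hbx, h⟩ := exists_gt_forall_le_of_deriv_eq_zero hx₀
  refine ⟨b, hb, fun m hm => ?_⟩
  rcases (le_of_mem_minPoints hm).eq_or_lt with rfl | hlt
  · exact hbx
  · obtain ⟨y, I, hy, hmI, hx, h0⟩ := exists_isSolution_of_mem_minPoints hm hlt
    exact h y I m hy hmI hx h0

theorem bddBelow_minPoints {x₀ : ℝ} (hx₀ : x₀ ≤ 0) : BddBelow (minPoints x₀) := by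
  have hlt : x₀ - 1 < x₀ := sub_one_lt x₀
  obtain ⟨b, -, hb, h⟩ := exists_gt_forall_le_of_deriv_eq_zero (hlt.trans_le hx₀)
  refine ⟨b, fun m hm => ?_⟩
  rcases le_or_gt (x₀ - 1) m with hle | hgt
  · exact hb.trans hle
  · obtain ⟨y, I, hy, hmI, hx, h0⟩ := exists_isSolution_of_mem_minPoints hm (hgt.trans hlt)
    exact h y I m hy hmI (hy.ordConnected.out hmI hx ⟨hgt.le, hlt.le⟩) h0

/-! ### The upper bound -/

namespace IsSolution

variable {y : ℝ → ℝ} {I : Set ℝ} {m t : ℝ}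

theorem riseTime_sqrt_le (h : IsSolution y I) (hm : m ∈ I) (h0 : deriv y m = 0) (ht : t ∈ I)
    (hmt : m ≤ t) (ht0 : t ≤ 0) (hm0 : m < 0) : riseTime (y m) (-m) √(y t - y m) ≤ t - m := by
  simpa using h.riseTime_sub_le_sub hm h0 ht le_rfl hmt ht0 (neg_pos.2 hm0) (by linarith)

/-- The force may be lowered to `c` at the height `y m + s ^ 2`, because by the time
`m + 2 * (-m - c)` needed for the average force to drop to `c` that height is not yet reached. -/
theorem twoStage_riseTime_le (h : IsSolution y I) (hm : m ∈ I) (h0 : deriv y m = 0)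
    (ht : t ∈ I) (hmt : m ≤ t) (ht0 : t ≤ 0) {c s : ℝ} (hc : 0 < c) (hcm : c < -m)
    (hs : 2 * (-m - c) ≤ riseTime (y m) (-m) s) :
    riseTime (y m) c √(y t - y m) - riseTime (y m) c s + riseTime (y m) (-m) s ≤ t - m := by
  have hm0 : 0 < -m := hc.trans hcm
  obtain ⟨q, hq⟩ : ∃ q, q = min t (m + 2 * (-m - c)) := ⟨_, rfl⟩
  have hmq : m ≤ q := hq ▸ le_min hmt (by linarith)
  have hqt : q ≤ t := hq ▸ min_le_left _ _
  have hqI : q ∈ I := h.ordConnected.out hm ht ⟨hmq, hqt⟩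
  have hfirst := h.riseTime_sqrt_le hm h0 hqI hmq (hqt.trans ht0) (neg_pos.1 hm0)
  have hheight : √(y q - y m) ≤ s := by
    refine (strictMono_riseTime (y m) hm0).le_iff_le.1 (hfirst.trans (le_trans ?_ hs))
    linarith [hq.trans_le (min_le_right _ _)]
  have hsecond : riseTime (y m) c √(y t - y m) - riseTime (y m) c √(y q - y m) ≤ t - q := by
    rcases min_choice t (m + 2 * (-m - c)) with hmin | hmin
    · simp [hq, hmin]
    · exact h.riseTime_sub_le_sub hm h0 ht hmq hqt ht0 hc (by linarith [hq.trans hmin])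
  have hdelay : riseTime (y m) c √(y q - y m) - riseTime (y m) (-m) √(y q - y m) ≤
      riseTime (y m) c s - riseTime (y m) (-m) s :=
    (strictMono_riseTime_sub (y m) hc hcm).monotone hheight
  linarith

end IsSolution

theorem IsMaximalSolution.mem_of_forall_le {y : ℝ → ℝ} {I : Set ℝ} (h : IsMaximalSolution y I)
    {m x₀ b : ℝ} (hm : m ∈ I) (h0 : deriv y m = 0) (hmx : m ≤ x₀) (hx₀ : x₀ ≤ 0)
    (hb : ∀ t ∈ I, m ≤ t → t ≤ x₀ → y t ≤ b) : x₀ ∈ I := by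
  have hcont : Continuous (squaredSpeed (y m) (-m)) := by unfold squaredSpeed; fun_prop
  obtain ⟨Z, hZ⟩ := (isCompact_Icc (a := y m) (b := b)).exists_bound_of_continuousOn
    hcont.continuousOn
  refine h.mem_of_bounded (B := max (max |y m| |b|) √Z) hm hmx fun t ht hmt htx => ?_
  have hyt : y t ∈ Icc (y m) b :=
    ⟨h.1.le_apply_of_le hm h0 ht hmt (htx.trans hx₀), hb t ht hmt htx⟩
  refine ⟨(abs_le_max_abs_abs hyt.1 hyt.2).trans (le_max_left _ _),
    (Real.abs_le_sqrt ?_).trans (le_max_right _ _)⟩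
  calc deriv y t ^ 2 ≤ squaredSpeed (y m) (-m) (y t) :=
        h.1.sq_deriv_le_squaredSpeed hm h0 ht hmt (htx.trans hx₀) (by linarith)
    _ ≤ Z := (le_abs_self _).trans (hZ _ hyt)

theorem neg_mem_minPoints {a M c s x₀ : ℝ} (hc : 0 < c) (hcM : c < M) (hMx : -M ≤ x₀)
    (hx₀ : x₀ ≤ 0) (hs : 2 * (M - c) ≤ riseTime a M s)
    (hblowup : x₀ + M < twoStageBlowupTime a M c s) : -M ∈ minPoints x₀ := by
  obtain ⟨y, I, hmax, hm, rfl, h0⟩ := exists_isMaximalSolution (-M) a 0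
  unfold twoStageBlowupTime at hblowup
  obtain ⟨S, hS⟩ := ((tendsto_riseTime (y (-M)) hc).eventually_const_lt (u :=
    x₀ + M + riseTime (y (-M)) c s - riseTime (y (-M)) M s) (by linarith)).exists
  have hx : x₀ ∈ I := hmax.mem_of_forall_le (b := y (-M) + S ^ 2) hm h0 hMx hx₀
    fun t ht hmt htx => by
      have htime := hmax.1.twoStage_riseTime_le hm h0 ht hmt (htx.trans hx₀) hc
        (by rwa [neg_neg]) (by rwa [neg_neg])
      rw [neg_neg] at htime
      have hheight : √(y t - y (-M)) < S :=
        (strictMono_riseTime (y (-M)) hc).lt_iff_lt.1 (by linarith)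
      linarith [Real.lt_sq_of_sqrt_lt hheight]
  exact ⟨y x₀, deriv y x₀, hmax.1.deriv_nonneg_of_le hm h0 hx hMx hx₀, y, I, hmax, hx, rfl, rfl,
    ⟨hm, hMx⟩, hmax.1.isMinOn_of_deriv_eq_zero hm h0 hMx hx₀⟩

/-- With the force lowered after a while, the solution with minimum `a` at `-M` lives strictly
longer than up to `x₀`, which leaves room for starting earlier than `-M`. -/
theorem exists_mem_minPoints_lt {a M x₀ : ℝ} (hM : 0 < M) (hMx : -M ≤ x₀) (hx₀ : x₀ ≤ 0)
    (hblowup : x₀ + M ≤ blowupTime a M) : ∃ m ∈ minPoints x₀, m < -M := by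
  have hrise : 0 < riseTime a M 1 := by simpa using strictMono_riseTime a hM one_pos
  obtain ⟨c, hmax, hcM⟩ := exists_between (max_lt hM (show M - riseTime a M 1 / 2 < M by linarith))
  obtain ⟨hc, hcrise⟩ := max_lt_iff.1 hmax
  have hriseTime : ∀ᶠ N in 𝓝 M, 2 * (N - c) < riseTime a N 1 :=
    ContinuousAt.eventually_lt (by fun_prop)
      ((continuousAt_riseTime zero_le_one (p := (a, M)) hM).comp
        (f := fun N : ℝ => (a, N)) (by fun_prop)) (by linarith)
  have htwoStage : ∀ᶠ N in 𝓝 M, x₀ + N < twoStageBlowupTime a N c 1 :=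
    ContinuousAt.eventually_lt (by fun_prop)
      ((continuousAt_twoStageBlowupTime (p := (a, M, c)) hM hc zero_le_one).comp
        (f := fun N : ℝ => (a, N, c)) (by fun_prop))
      (hblowup.trans_lt (blowupTime_lt_twoStageBlowupTime hc hcM))
  obtain ⟨N, ⟨hN, hN'⟩, hMN⟩ := (((hriseTime.and htwoStage).filter_mono
    (nhdsWithin_le_nhds (s := Ioi M))).and self_mem_nhdsWithin).exists
  exact ⟨-N, neg_mem_minPoints hc (hcM.trans hMN) (by linarith) hx₀ hN.le hN', neg_lt_neg hMN⟩

/-! ### Explicit bounds -/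

theorem existsUnique_root {k D : ℝ} (hk : 0 ≤ k) (hD : 0 < D) :
    ∃! η : ℝ, 0 < η ∧ η ^ 5 - k * η = D := by
  have hlt : ∀ ξ η : ℝ, 0 < ξ → ξ < η → ξ ^ 5 - k * ξ = D → D < η ^ 5 - k * η := by
    intro ξ η hξ hξη h
    have hfactor : ξ * (ξ ^ 4 - k) = D := by rw [← h]; ring
    have hpos : 0 < ξ ^ 4 - k := pos_of_mul_pos_right (hfactor ▸ hD) hξ.le
    calc D = ξ * (ξ ^ 4 - k) := hfactor.symm
      _ < η * (η ^ 4 - k) := by gcongr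
      _ = η ^ 5 - k * η := by ring
  obtain ⟨N, hN⟩ : ∃ N, N = 1 + k + D := ⟨_, rfl⟩
  have hN1 : 1 ≤ N := by linarith
  have hDN : D ≤ N ^ 5 - k * N := by
    have : N ≤ N ^ 4 := le_self_pow₀ hN1 (by norm_num)
    calc D ≤ N ^ 4 - k := by linarith
      _ ≤ N * (N ^ 4 - k) := le_mul_of_one_le_left (by linarith) hN1
      _ = N ^ 5 - k * N := by ring
  obtain ⟨η, hη, hroot⟩ := intermediate_value_Icc (zero_le_one.trans hN1)
    (f := fun η : ℝ => η ^ 5 - k * η) (by fun_prop) ⟨by simpa using hD.le, hDN⟩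
  have hη0 : 0 < η := hη.1.lt_of_ne <| by
    rintro rfl
    simp [hD.ne] at hroot
  refine ⟨η, ⟨hη0, hroot⟩, fun ξ ⟨hξ0, hξ⟩ => ?_⟩
  rcases lt_trichotomy ξ η with h | h | h
  · exact absurd hroot (hlt ξ η hξ0 h hξ).ne'
  · exact h
  · exact absurd hξ (hlt η ξ hη0 h hroot).ne'

theorem four_mul_pow_mul_sub_le {q r : ℝ} (hq : 0 ≤ q) (hqr : q ≤ r) :
    4 * q ^ 3 * (r - q) ≤ r ^ 4 - q ^ 4 := by
  have : 0 ≤ r - q := sub_nonneg.2 hqr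
  calc 4 * q ^ 3 * (r - q) = (q ^ 3 + q ^ 2 * q + q * q ^ 2 + q ^ 3) * (r - q) := by ring
    _ ≤ (r ^ 3 + r ^ 2 * q + r * q ^ 2 + q ^ 3) * (r - q) := by gcongr
    _ = r ^ 4 - q ^ 4 := by ring

theorem div_rpow_sub_div_rpow_le {k D : ℝ} (hk : 0 < k) (hD : 0 < D) :
    D / k ^ (1 / 4 : ℝ) - D / |(k + D / k ^ (1 / 4 : ℝ))| ^ (1 / 4 : ℝ)
      ≤ D ^ 2 / (4 * k ^ (3 / 2 : ℝ)) := by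
  have hsixth : k ^ (3 / 2 : ℝ) = (k ^ (1 / 4 : ℝ)) ^ 6 := by
    rw [← Real.rpow_natCast, ← Real.rpow_mul hk.le]; norm_num
  have hq := Real.rpow_pos_of_pos hk (1 / 4)
  have hqk := rpow_quarter_pow hk.le
  rw [hsixth, abs_of_pos (by positivity)]
  generalize k ^ (1 / 4 : ℝ) = q at hq hqk ⊢
  have hrk : ((k + D / q) ^ (1 / 4 : ℝ)) ^ 4 = k + D / q := rpow_quarter_pow (by positivity)
  have hr : 0 < (k + D / q) ^ (1 / 4 : ℝ) := Real.rpow_pos_of_pos (by positivity) _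
  generalize (k + D / q) ^ (1 / 4 : ℝ) = r at hr hrk ⊢
  have hgap : r ^ 4 - q ^ 4 = D / q := by rw [hrk, hqk, add_sub_cancel_left]
  have hqr : q ≤ r := by
    refine le_of_pow_le_pow_left₀ four_ne_zero hr.le ?_
    rw [hrk, hqk]
    exact le_add_of_nonneg_right (by positivity)
  calc D / q - D / r = D * (4 * q ^ 3 * (r - q)) / (4 * q ^ 4 * r) := by field_simp
    _ ≤ D * (D / q) / (4 * q ^ 4 * q) := by
        gcongr
        exact hgap ▸ four_mul_pow_mul_sub_le hq.le hqr
    _ = D ^ 2 / (4 * q ^ 6) := by field_simp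

section Xmin

variable {x₀ η : ℝ}

theorem neg_root_pow_eq (hx₀ : x₀ ≤ 0) (hη : 0 < η) (hroot : η ^ 5 - |x₀| * η = C) :
    -η ^ 4 = x₀ - C / η := by
  rw [← hroot, abs_of_nonpos hx₀]
  field_simp
  ring

theorem exists_mem_minPoints_lt_of_root (hx₀ : x₀ ≤ 0) (hη : 0 < η)
    (hroot : η ^ 5 - |x₀| * η = C) : ∃ m ∈ minPoints x₀, m < -η ^ 4 := by
  obtain ⟨v, hv⟩ := exists_ellipticIntegral_eq_C
  have hpow := neg_root_pow_eq hx₀ hη hroot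
  have hpos : 0 < C / η := div_pos C_pos hη
  refine exists_mem_minPoints_lt (a := η ^ 2 * v) (by positivity) (by linarith) hx₀ ?_
  rw [blowupTime_scaling hη, hv]
  linarith

theorem Xmin_lt (hx₀ : x₀ ≤ 0) (hη : 0 < η) (hroot : η ^ 5 - |x₀| * η = C) :
    Xmin x₀ < -η ^ 4 := by
  obtain ⟨m, hm, hlt⟩ := exists_mem_minPoints_lt_of_root hx₀ hη hroot
  exact (csInf_le (bddBelow_minPoints hx₀) hm).trans_lt hlt

theorem minPoints_nonempty (hx₀ : x₀ ≤ 0) : (minPoints x₀).Nonempty := by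
  obtain ⟨η, ⟨hη, hroot⟩, -⟩ := existsUnique_root (abs_nonneg x₀) C_pos
  obtain ⟨m, hm, -⟩ := exists_mem_minPoints_lt_of_root hx₀ hη hroot
  exact ⟨m, hm⟩

theorem sub_lt_Xmin (hx₀ : x₀ < 0) : x₀ - C / |x₀| ^ (1 / 4 : ℝ) < Xmin x₀ := by
  obtain ⟨b, hb, h⟩ := exists_gt_forall_mem_minPoints_le hx₀
  exact hb.trans_le (le_csInf (minPoints_nonempty hx₀.le) h)

theorem Xmin_lt_sub (hx₀ : x₀ < 0) :
    Xmin x₀ < x₀ - C / |(|x₀| + C / |x₀| ^ (1 / 4 : ℝ))| ^ (1 / 4 : ℝ) := by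
  obtain ⟨η, ⟨hη, hroot⟩, -⟩ := existsUnique_root (abs_nonneg x₀) C_pos
  have hC := C_pos
  have hk : 0 < |x₀| := abs_pos.2 hx₀.ne
  have : 0 < |x₀| ^ (1 / 4 : ℝ) := Real.rpow_pos_of_pos hk _
  have hpow : η ^ 4 = |x₀| + C / η := by
    linarith [neg_root_pow_eq hx₀.le hη hroot, abs_of_neg hx₀]
  have hqη : |x₀| ^ (1 / 4 : ℝ) ≤ η := by
    refine le_of_pow_le_pow_left₀ four_ne_zero hη.le ?_
    rw [rpow_quarter_pow hk.le, hpow]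
    exact le_add_of_nonneg_right (div_pos hC hη).le
  have hle : η ≤ (|x₀| + C / |x₀| ^ (1 / 4 : ℝ)) ^ (1 / 4 : ℝ) := by
    refine le_of_pow_le_pow_left₀ four_ne_zero (by positivity) ?_
    rw [rpow_quarter_pow (by positivity), hpow]
    gcongr
  rw [abs_of_pos (by positivity : 0 < |x₀| + C / |x₀| ^ (1 / 4 : ℝ))]
  calc Xmin x₀ < -η ^ 4 := Xmin_lt hx₀.le hη hroot
    _ = x₀ - C / η := neg_root_pow_eq hx₀.le hη hroot
    _ ≤ x₀ - C / (|x₀| + C / |x₀| ^ (1 / 4 : ℝ)) ^ (1 / 4 : ℝ) := by gcongr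

theorem remainder_mem_Ioo (hx₀ : x₀ < 0) :
    Xmin x₀ - (x₀ - C / |x₀| ^ (1 / 4 : ℝ)) ∈ Ioo 0 (C ^ 2 / (4 * |x₀| ^ (3 / 2 : ℝ))) := by
  have hlower := sub_lt_Xmin hx₀
  have hupper := Xmin_lt_sub hx₀
  have hgap := div_rpow_sub_div_rpow_le (abs_pos.2 hx₀.ne) C_pos
  exact ⟨by linarith, by linarith⟩

theorem isBigO_remainder :
    (fun x₀ : ℝ => Xmin x₀ - (x₀ - C / |x₀| ^ (1 / 4 : ℝ))) =O[atBot]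
      fun x₀ : ℝ => 1 / |x₀| ^ (3 / 2 : ℝ) := by
  refine Asymptotics.IsBigO.of_bound (C ^ 2 / 4) ?_
  filter_upwards [eventually_lt_atBot 0] with x₀ hx₀
  obtain ⟨hlower, hupper⟩ := remainder_mem_Ioo hx₀
  rw [Real.norm_of_nonneg hlower.le, Real.norm_of_nonneg (by positivity)]
  exact hupper.le.trans_eq (by ring)

end Xmin

end PainleveOne

theorem corollary2p1_general :
    IsGreatest (PainleveOne.ellipticIntegral '' Set.Iio 0) PainleveOne.C ∧
    (∀ x₀ : ℝ, x₀ ≤ 0 →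
      (PainleveOne.minPoints x₀).Nonempty ∧ BddBelow (PainleveOne.minPoints x₀)) ∧
    (∀ x₀ : ℝ, x₀ ≤ 0 →
      (∃! η : ℝ, 0 < η ∧ η ^ 5 - |x₀| * η = PainleveOne.C) ∧
      ∀ η : ℝ, 0 < η → η ^ 5 - |x₀| * η = PainleveOne.C →
        PainleveOne.Xmin x₀ < -η ^ 4 ∧ -η ^ 4 = x₀ - PainleveOne.C / η) ∧
    (∀ x₀ : ℝ, x₀ < 0 →
      x₀ - PainleveOne.C / |x₀| ^ (1 / 4 : ℝ) < PainleveOne.Xmin x₀ ∧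
      PainleveOne.Xmin x₀ <
        x₀ - PainleveOne.C /
          |(|x₀| + PainleveOne.C / |x₀| ^ (1 / 4 : ℝ))| ^ (1 / 4 : ℝ)) ∧
    Asymptotics.IsBigO Filter.atBot
      (fun x₀ : ℝ => PainleveOne.Xmin x₀ - (x₀ - PainleveOne.C / |x₀| ^ (1 / 4 : ℝ)))
      (fun x₀ : ℝ => 1 / |x₀| ^ (3 / 2 : ℝ)) ∧
    (∀ x₀ : ℝ, x₀ < 0 →
      0 < PainleveOne.Xmin x₀ - (x₀ - PainleveOne.C / |x₀| ^ (1 / 4 : ℝ)) ∧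
      PainleveOne.Xmin x₀ - (x₀ - PainleveOne.C / |x₀| ^ (1 / 4 : ℝ)) <
        PainleveOne.C ^ 2 / (4 * |x₀| ^ (3 / 2 : ℝ))) := by
  open PainleveOne in
  exact ⟨isGreatest_C, fun x₀ hx₀ => ⟨minPoints_nonempty hx₀, bddBelow_minPoints hx₀⟩,
    fun x₀ hx₀ => ⟨existsUnique_root (abs_nonneg x₀) C_pos,
      fun η hη hroot => ⟨Xmin_lt hx₀ hη hroot, neg_root_pow_eq hx₀ hη hroot⟩⟩,
    fun x₀ hx₀ => ⟨sub_lt_Xmin hx₀, Xmin_lt_sub hx₀⟩, isBigO_remainder,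
    fun x₀ hx₀ => remainder_mem_Ioo hx₀⟩

theorem corollary2p1 :
    -- `C` is indeed a maximum
    IsGreatest (PainleveOne.ellipticIntegral '' Set.Iio 0) PainleveOne.C ∧
    -- `X_min(x₀)` is the infimum of a nonempty set that is bounded below
    (∀ x₀ : ℝ, x₀ ≤ 0 →
      (PainleveOne.minPoints x₀).Nonempty ∧ BddBelow (PainleveOne.minPoints x₀)) ∧
    -- the bound through the unique positive root `η` of `η⁵ - |x₀| η = C`
    (∀ x₀ : ℝ, x₀ ≤ 0 →
      (∃! η : ℝ, 0 < η ∧ η ^ 5 - |x₀| * η = PainleveOne.C) ∧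
      ∀ η : ℝ, 0 < η → η ^ 5 - |x₀| * η = PainleveOne.C →
        PainleveOne.Xmin x₀ < -η ^ 4 ∧ -η ^ 4 = x₀ - PainleveOne.C / η) ∧
    -- the two-sided bound
    (∀ x₀ : ℝ, x₀ < 0 →
      x₀ - PainleveOne.C / |x₀| ^ (1 / 4 : ℝ) < PainleveOne.Xmin x₀ ∧
      PainleveOne.Xmin x₀ <
        x₀ - PainleveOne.C /
          |(|x₀| + PainleveOne.C / |x₀| ^ (1 / 4 : ℝ))| ^ (1 / 4 : ℝ)) ∧
    -- the asymptotics as `x₀ → -∞`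
    Asymptotics.IsBigO Filter.atBot
      (fun x₀ : ℝ => PainleveOne.Xmin x₀ - (x₀ - PainleveOne.C / |x₀| ^ (1 / 4 : ℝ)))
      (fun x₀ : ℝ => 1 / |x₀| ^ (3 / 2 : ℝ)) ∧
    -- the explicit bound on the remainder
    (∀ x₀ : ℝ, x₀ ≤ 0 → PainleveOne.C ^ (4 / 5 : ℝ) < |x₀| →
      0 < PainleveOne.Xmin x₀ - (x₀ - PainleveOne.C / |x₀| ^ (1 / 4 : ℝ)) ∧
      PainleveOne.Xmin x₀ - (x₀ - PainleveOne.C / |x₀| ^ (1 / 4 : ℝ)) <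
        PainleveOne.C ^ 2 / (4 * |x₀| ^ (3 / 2 : ℝ))) := by
  obtain ⟨hC, hfin, hroot, hbounds, hasymp, hremainder⟩ := corollary2p1_general
  exact ⟨hC, hfin, hroot, hbounds, hasymp, fun x₀ hx₀ hlt => hremainder x₀ <| hx₀.lt_of_ne <|
    abs_pos.1 <| (Real.rpow_nonneg PainleveOne.C_pos.le _).trans_lt hlt⟩
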